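/- Let $q$ be a prime power and let $L$ be an $n$-dimensional Lie algebra over the finite field $\mathbb{F}_q$ that is nilpotent of class $3$, with derived subalgebra $L^2=[L,L]$ of dimension $2$ and centre $Z(L)$ of dimension $1$ (under the other hypotheses, equivalently $Z(L)\subseteq L^2$). Let $$d(L)=\frac{|\{(x,y)\in L\times L : [x,y]=0\}|}{|L|^2}$$ be its commutativity degree. Then $$d(L)=\begin{cases}\dfrac{q^{2}-q}{q^{n}}+\dfrac{q^{2}+q-1}{q^{4}} & \text{if } n \text{ is even},\\[2mm] \dfrac{q-1}{q^{n}}+\dfrac{q^{2}+q-1}{q^{4}} & \text{if } n \text{ is odd}.\end{cases}$$ -/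

import Mathlib

/-- The commutativity degree of a finite Lie algebra `L`: the proportion of pairs
`(x, y)` in `L × L` with `⁅x, y⁆ = 0`. -/
noncomputable def lieCommDegree (L : Type*) [LieRing L] : ℚ :=
  (Nat.card {p : L × L // ⁅p.1, p.2⁆ = 0} : ℚ) / (Nat.card L : ℚ) ^ 2

open Module

/-! ### Ranks of alternating forms -/

section LinearAlgebra

variable {K V : Type*} [Field K] [AddCommGroup V] [Module K V] [Module.Finite K V]

/-! Let `z` span the centre and `y`, `z` span `L^2`. The coordinates of the bracket are alternating
forms `f` (along `y`) and `g` (along `z`), and commuting pairs are their common zeros. These are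
counted through the `q + 1` forms `f`, `g + c • f` of the pencil, each of whose zero counts depends
only on its radical. The Jacobi identity forces `f` to have rank 2 and each `g + c • f` to have
radical of dimension 1 or 2; since alternating rank is even, the parity of `n` decides which
(`exists_forms`, `lieCommDegree_eq`). -/

theorem finrank_ker_prod_add_two (a b : V →ₗ[K] K) {u v : V} (hau : a u = 1) (hbu : b u = 0)
    (hbv : b v ≠ 0) : finrank K (LinearMap.ker (a.prod b)) + 2 = finrank K V := by
  have hs : Function.Surjective (a.prod b) := by
    rintro ⟨s, t⟩
    refine ⟨s • u + (t / b v) • (v - a v • u), ?_⟩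
    ext <;> simp [hau, hbu, hbv]
  have h := (a.prod b).finrank_range_add_finrank_ker
  rw [LinearMap.range_eq_top.2 hs, finrank_top, Module.finrank_prod, Module.finrank_self] at h
  omega

omit [Module.Finite K V] in
theorem exists_functional_eq_one_eq_zero {v w : V} (h : v ∉ Submodule.span K {w}) :
    ∃ a : V →ₗ[K] K, a v = 1 ∧ a w = 0 := by
  obtain ⟨a, hav, ha⟩ := Submodule.exists_le_ker_of_notMem h
  have haw : a w = 0 := ha (Submodule.mem_span_singleton_self w)
  exact ⟨(a v)⁻¹ • a, by simp [hav], by simp [haw]⟩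

/-- An alternating bilinear form has even rank. -/
theorem LinearMap.IsAlt.exists_finrank_eq_finrank_ker_add_two_mul {B : V →ₗ[K] V →ₗ[K] K}
    (hB : B.IsAlt) : ∃ k, finrank K V = finrank K (LinearMap.ker B) + 2 * k := by
  induction hd : finrank K V using Nat.strong_induction_on generalizing V with
  | _ d ih =>
  by_cases h0 : B = 0
  · subst h0
    exact ⟨0, by rw [LinearMap.ker_zero, finrank_top, hd, mul_zero, add_zero]⟩
  obtain ⟨u, v, huv⟩ : ∃ u v, B u v ≠ 0 := by
    by_contra! h
    exact h0 (LinearMap.ext₂ h)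
  have hvu : B v u ≠ 0 := by
    rw [← hB.neg]
    simpa using huv
  -- `W` is the orthogonal complement of the hyperbolic plane spanned by `u`, `v`; restricting to it
  -- keeps the radical.
  let W := LinearMap.ker ((B u).prod (B v))
  have hmem (w : V) : w ∈ W ↔ B u w = 0 ∧ B v w = 0 := by
    simp [W]
  have hW : finrank K W + 2 = finrank K V := by
    have h := finrank_ker_prod_add_two ((B v u)⁻¹ • B v) (B u) (u := u) (v := v)
      (by simp [hvu]) (hB u) huv
    rw [← h]
    refine congrArg (fun S : Submodule K V => finrank K S + 2) (Submodule.ext fun w => ?_)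
    simp [hmem, hvu, and_comm]
  let B' : W →ₗ[K] W →ₗ[K] K := B.domRestrict₁₂ W W
  have hB' : B'.IsAlt := fun x => hB x
  have hker : (LinearMap.ker B').map W.subtype = LinearMap.ker B := by
    ext x
    simp only [Submodule.mem_map, LinearMap.mem_ker, Submodule.subtype_apply]
    constructor
    · rintro ⟨x, hx, rfl⟩
      obtain ⟨hxu, hxv⟩ := (hmem x).1 x.2
      have hxu' : B x u = 0 := by rw [← hB.neg, hxu, neg_zero]
      have hxv' : B x v = 0 := by rw [← hB.neg, hxv, neg_zero]
      ext w
      -- Projection of `w` to `W` along `u`, `v`, both orthogonal to `x`.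
      have hw : w - (B v w / B v u) • u - (B u w / B u v) • v ∈ W := by
        rw [hmem]
        constructor
        · simp [hB u, huv]
        · simp [hB v, hvu]
      have := LinearMap.congr_fun hx ⟨_, hw⟩
      simpa [B', LinearMap.domRestrict₁₂_apply, hxu', hxv'] using this
    · intro hx
      refine ⟨⟨x, (hmem x).2 ⟨?_, ?_⟩⟩, ?_, rfl⟩
      · rw [← hB.neg, hx]; simp
      · rw [← hB.neg, hx]; simp
      · ext w
        simp [B', LinearMap.domRestrict₁₂_apply, hx]
  obtain ⟨k, hk⟩ := ih _ (by omega) hB' rfl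
  have : finrank K (LinearMap.ker B') = finrank K (LinearMap.ker B) := by
    rw [← hker]
    exact (LinearEquiv.finrank_eq (Submodule.equivMapOfInjective W.subtype
      W.injective_subtype (LinearMap.ker B')))
  exact ⟨k + 1, by omega⟩

end LinearAlgebra

/-! ### Counting zeros of forms -/

section Counting

variable {K V : Type*} [Field K] [Finite K] [AddCommGroup V] [Module K V] [Module.Finite K V]

omit [Finite K] in
theorem natCard_mul_natCard_ker (a : V →ₗ[K] K) [Decidable (a = 0)] :
    (Nat.card K : ℚ) * Nat.card (LinearMap.ker a) =
      Nat.card V + if a = 0 then ((Nat.card K : ℚ) - 1) * Nat.card V else 0 := by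
  split_ifs with h
  · subst h
    rw [LinearMap.ker_zero, Nat.card_congr (Submodule.topEquiv (R := K) (M := V)).toEquiv]
    ring
  · have h1 := a.finrank_range_add_finrank_ker
    rw [LinearMap.range_eq_top.2 (LinearMap.surjective h), finrank_top, finrank_self] at h1
    rw [Module.natCard_eq_pow_finrank (K := K) (V := V), ← h1,
      Module.natCard_eq_pow_finrank (K := K) (V := LinearMap.ker a)]
    push_cast
    ring

/-- The number of zeros of a bilinear form in terms of its left radical. -/
theorem natCard_mul_natCard_zeros (B : V →ₗ[K] V →ₗ[K] K) :
    (Nat.card K : ℚ) * Nat.card {p : V × V // B p.1 p.2 = 0} =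
      (Nat.card V : ℚ) ^ 2 +
        ((Nat.card K : ℚ) - 1) * Nat.card V * Nat.card (LinearMap.ker B) := by
  classical
  have : Finite V := Module.finite_of_finite K
  have := Fintype.ofFinite V
  let e : {p : V × V // B p.1 p.2 = 0} ≃ Σ x : V, LinearMap.ker (B x) :=
    { toFun := fun p => ⟨p.1.1, p.1.2, p.2⟩
      invFun := fun s => ⟨(s.1, s.2.1), s.2.2⟩
      left_inv := fun _ => rfl
      right_inv := fun _ => rfl }
  rw [Nat.card_congr e, Nat.card_sigma]
  push_cast
  rw [Finset.mul_sum]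
  simp only [natCard_mul_natCard_ker]
  rw [Finset.sum_add_distrib, ← Finset.sum_filter, Finset.sum_const, Finset.sum_const]
  have h : (Finset.univ.filter fun x => B x = 0).card = Nat.card (LinearMap.ker B) := by
    rw [← Fintype.card_subtype, ← Nat.card_eq_fintype_card]
    rfl
  rw [h, Finset.card_univ, ← Nat.card_eq_fintype_card]
  simp only [nsmul_eq_mul]
  ring

omit [Finite K] in
-- A common zero is counted by all `q + 1` terms on the left, any other `p` by exactly one.
theorem natCard_zeros_add_sum [Fintype K] {P : Type*} [Finite P] (s t : P → K) :
    (Nat.card {p // s p = 0} : ℚ) + ∑ c : K, (Nat.card {p // t p + c * s p = 0} : ℚ) =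
      Nat.card K * Nat.card {p // s p = 0 ∧ t p = 0} + Nat.card P := by
  classical
  have := Fintype.ofFinite P
  have hc (r : P → Prop) [DecidablePred r] :
      (Nat.card {p // r p} : ℚ) = ∑ p, if r p then 1 else 0 := by
    rw [Nat.card_eq_fintype_card, Fintype.card_subtype, Finset.sum_boole]
  have hP : (Nat.card P : ℚ) = ∑ _p : P, 1 := by simp
  simp only [hc]
  rw [Finset.sum_comm, hP, Finset.mul_sum, ← Finset.sum_add_distrib, ← Finset.sum_add_distrib]
  refine Finset.sum_congr rfl fun p _ => ?_
  by_cases hs : s p = 0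
  · by_cases ht : t p = 0
    · simp [hs, ht, add_comm]
    · simp [hs, ht]
  · have h (c : K) : t p + c * s p = 0 ↔ c = -t p / s p := by
      rw [eq_div_iff hs, add_comm, add_eq_zero_iff_eq_neg]
    simp [hs, h]

/-- The number of common zeros of two bilinear forms, when all the forms `g + c • f` have left
radicals of the same cardinality `r`. -/
theorem natCard_common_zeros (f g : V →ₗ[K] V →ₗ[K] K) (r : ℚ)
    (hr : ∀ c : K, (Nat.card (LinearMap.ker (g + c • f)) : ℚ) = r) :
    (Nat.card K : ℚ) ^ 2 * Nat.card {p : V × V // f p.1 p.2 = 0 ∧ g p.1 p.2 = 0} =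
      (Nat.card V : ℚ) ^ 2 + ((Nat.card K : ℚ) - 1) * Nat.card V *
        (Nat.card (LinearMap.ker f) + Nat.card K * r) := by
  have := Fintype.ofFinite K
  have : Finite V := Module.finite_of_finite K
  have h := natCard_zeros_add_sum (fun p : V × V => f p.1 p.2) (fun p : V × V => g p.1 p.2)
  have hf := natCard_mul_natCard_zeros f
  have hg : (Nat.card K : ℚ) *
      ∑ c : K, (Nat.card {p : V × V // g p.1 p.2 + c * f p.1 p.2 = 0} : ℚ) =
      Nat.card K * ((Nat.card V : ℚ) ^ 2 + ((Nat.card K : ℚ) - 1) * Nat.card V * r) := by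
    rw [Finset.mul_sum, Nat.card_eq_fintype_card (α := K), ← nsmul_eq_mul, ← Finset.card_univ,
      ← Finset.sum_const]
    refine Finset.sum_congr rfl fun c _ => ?_
    rw [Finset.card_univ, ← Nat.card_eq_fintype_card (α := K), ← hr c,
      ← natCard_mul_natCard_zeros]
    simp
  rw [Nat.card_prod] at h
  push_cast at h
  linear_combination hf + hg - (Nat.card K : ℚ) * h

end Counting

/-! ### Lie algebras of class 3 -/

section Lie

variable {K L : Type*} [Field K] [LieRing L] [LieAlgebra K L]

/-- Composition of the Lie bracket with a linear functional. -/
def lieForm (φ : L →ₗ[K] K) : L →ₗ[K] L →ₗ[K] K :=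
  (LieModule.toEnd K L L : L →ₗ[K] Module.End K L).compr₂ φ

@[simp]
theorem lieForm_apply (φ : L →ₗ[K] K) (x w : L) : lieForm φ x w = φ ⁅x, w⁆ := rfl

theorem lieForm_isAlt (φ : L →ₗ[K] K) : (lieForm φ).IsAlt := fun x => by simp

variable [Module.Finite K L]

/-- Adapted coordinates on a Lie algebra of class `3` with derived subalgebra of dimension `2` and
centre of dimension `1`. -/
theorem exists_adapted_functionals (hclass : LieModule.nilpotencyLength L L = 3)
    (hderived : finrank K (LieAlgebra.derivedSeries K L 1) = 2)
    (hcenter : finrank K (LieAlgebra.center K L) = 1) :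
    ∃ (y z : L) (φ ψ : L →ₗ[K] K),
      (∀ x w : L, ⁅x, w⁆ = φ ⁅x, w⁆ • y + ψ ⁅x, w⁆ • z) ∧
      (∀ x : L, (∀ w : L, ⁅x, w⁆ = 0) ↔ ∃ c : K, x = c • z) ∧
      φ y = 1 ∧ φ z = 0 ∧ ψ z = 1 ∧ z ≠ 0 ∧ (∀ w : L, φ ⁅y, w⁆ = 0) ∧
      (∃ x w : L, φ ⁅x, w⁆ ≠ 0) := by
  rw [LieModule.nilpotencyLength_eq_succ_iff K] at hclass
  obtain ⟨h3, h2⟩ := hclass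
  let D : Submodule K L := (LieAlgebra.derivedSeries K L 1).toSubmodule
  have hDs : D = Submodule.span K {⁅x, y⁆ | (x : L) (y : L)} :=
    LieAlgebra.coe_derivedSeries_one_eq K L
  have hlD (x w : L) : ⁅x, w⁆ ∈ D := by
    rw [hDs]
    exact Submodule.subset_span ⟨x, w, rfl⟩
  have hD1 : LieModule.lowerCentralSeries K L L 1 = LieAlgebra.derivedSeries K L 1 := by
    simp
  have hcen (x : L) : x ∈ LieAlgebra.center K L ↔ ∀ w : L, ⁅x, w⁆ = 0 := by
    rw [LieModule.mem_maxTrivSubmodule]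
    refine forall_congr' fun w => ?_
    rw [← lie_skew, neg_eq_zero]
  have h2c : LieModule.lowerCentralSeries K L L 2 ≤ LieAlgebra.center K L := by
    rw [LieModule.le_max_triv_iff_bracket_eq_bot]
    exact h3
  -- Taking `z` in `L^3` puts it in both the centre and `L^2`.
  obtain ⟨z, hz2, hz0⟩ := Submodule.exists_mem_ne_zero_of_ne_bot
    (p := (LieModule.lowerCentralSeries K L L 2).toSubmodule) (by simpa using h2)
  have hzc := h2c hz2
  have hzD : z ∈ D := by
    have := LieModule.antitone_lowerCentralSeries K L L (show 1 ≤ 2 by norm_num) hz2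
    rw [hD1] at this
    exact this
  have hspan (x : L) (hx : x ∈ LieAlgebra.center K L) : ∃ c : K, x = c • z := by
    obtain ⟨c, hc⟩ := (finrank_eq_one_iff_of_nonzero'
      (⟨z, hzc⟩ : LieAlgebra.center K L) (by simpa using hz0)).1 hcenter ⟨x, hx⟩
    exact ⟨c, (congrArg Subtype.val hc).symm⟩
  obtain ⟨y, hyD, hyz⟩ : ∃ y ∈ D, y ∉ Submodule.span K {z} := by
    by_contra! h
    have h1 : finrank K D ≤ finrank K (Submodule.span K {z}) := Submodule.finrank_mono h
    have h4 : finrank K D = 2 := hderived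
    rw [finrank_span_singleton hz0] at h1
    omega
  have hli : LinearIndependent K ![y, z] := by
    rw [LinearIndependent.pair_iff' (by rintro rfl; simp at hyz)]
    intro a ha
    have ha0 : a ≠ 0 := by rintro rfl; simp at ha; exact hz0 ha.symm
    refine hyz (Submodule.mem_span_singleton.2 ⟨a⁻¹, ?_⟩)
    rw [← ha, inv_smul_smul₀ ha0]
  have hDspan : D = Submodule.span K {y, z} := by
    symm
    refine Submodule.eq_of_le_of_finrank_eq ?_ ?_
    · rw [Submodule.span_le]
      rintro _ (rfl | rfl)
      exacts [hyD, hzD]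
    · have := finrank_span_eq_card hli
      rw [Matrix.range_cons_cons_empty] at this
      exact this.trans hderived.symm
  obtain ⟨φ, hφ⟩ : ∃ φ : L →ₗ[K] K, φ y = 1 ∧ φ z = 0 := exists_functional_eq_one_eq_zero hyz
  obtain ⟨ψ, hψ⟩ : ∃ ψ : L →ₗ[K] K, ψ z = 1 ∧ ψ y = 0 := by
    refine exists_functional_eq_one_eq_zero fun h => ?_
    obtain ⟨a, ha⟩ := Submodule.mem_span_singleton.1 h
    have := (LinearIndependent.pair_iff.1 hli a (-1) (by rw [ha]; simp)).2
    simp at this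
  have hdec (v : L) (hv : v ∈ D) : v = φ v • y + ψ v • z := by
    rw [hDspan, Submodule.mem_span_pair] at hv
    obtain ⟨a, c, rfl⟩ := hv
    simp [hφ, hψ]
  refine ⟨y, z, φ, ψ, fun x w => hdec _ (hlD x w), fun x => ⟨fun h => hspan x ((hcen x).2 h), ?_⟩,
    hφ.1, hφ.2, hψ.1, hz0, fun w => ?_, ?_⟩
  · rintro ⟨c, rfl⟩ w
    rw [smul_lie, (hcen z).1 hzc, smul_zero]
  · have h : ⁅y, w⁆ ∈ LieAlgebra.center K L := by
      rw [← lie_skew]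
      refine neg_mem (h2c ?_)
      rw [LieModule.lowerCentralSeries_succ]
      refine LieSubmodule.lie_mem_lie (LieSubmodule.mem_top w) ?_
      rw [hD1]
      exact hyD
    obtain ⟨c, hc⟩ := hspan _ h
    rw [hc, map_smul, hφ.2, smul_zero]
  · by_contra! h
    have : D ≤ LinearMap.ker φ := by
      rw [hDs, Submodule.span_le]
      rintro _ ⟨x, w, rfl⟩
      exact h x w
    have := this hyD
    simp [hφ.1] at this

theorem exists_forms (hclass : LieModule.nilpotencyLength L L = 3)
    (hderived : finrank K (LieAlgebra.derivedSeries K L 1) = 2)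
    (hcenter : finrank K (LieAlgebra.center K L) = 1) :
    ∃ f g : L →ₗ[K] L →ₗ[K] K,
      (∀ x w : L, ⁅x, w⁆ = 0 ↔ f x w = 0 ∧ g x w = 0) ∧
      finrank K (LinearMap.ker f) + 2 = finrank K L ∧
      ∀ c : K, (g + c • f).IsAlt ∧ 1 ≤ finrank K (LinearMap.ker (g + c • f)) ∧
        finrank K (LinearMap.ker (g + c • f)) ≤ 2 := by
  obtain ⟨y, z, φ, ψ, hdec, hcen, hφy, hφz, hψz, hz0, hyw, x₀, w₀, h₀⟩ :=
    exists_adapted_functionals hclass hderived hcenter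
  have hzl (w : L) : ⁅z, w⁆ = 0 := (hcen z).2 ⟨1, by simp⟩ w
  have hyl (w : L) : ⁅y, w⁆ = ψ ⁅y, w⁆ • z := by
    have := hdec y w
    rwa [hyw, zero_smul, zero_add] at this
  have hlie (a b c : L) : ψ ⁅⁅a, b⁆, c⁆ = φ ⁅a, b⁆ * ψ ⁅y, c⁆ := by
    rw [hdec a b]
    simp [hzl, hφy, hφz]
  have hskew (χ : L →ₗ[K] K) (a b : L) : χ ⁅a, b⁆ = -χ ⁅b, a⁆ := by
    rw [← lie_skew, map_neg]
  obtain ⟨u₀, hu₀⟩ : ∃ u, ψ ⁅y, u⁆ ≠ 0 := by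
    by_contra! h
    obtain ⟨c, hc⟩ := (hcen y).1 fun w => by rw [hyl, h, zero_smul]
    rw [hc, map_smul, hφz, smul_zero] at hφy
    exact zero_ne_one hφy
  obtain ⟨u, hu⟩ : ∃ u, ψ ⁅y, u⁆ = 1 :=
    ⟨(ψ ⁅y, u₀⁆)⁻¹ • u₀, by simp [hu₀]⟩
  -- `ψ` of the Jacobi identity for `a, b, u`, where `ψ ⁅y, u⁆ = 1`: `φ ⁅·, ·⁆` is a wedge of two
  -- functionals, hence of rank 2.
  have hjac (a b : L) : φ ⁅a, b⁆ = φ ⁅u, b⁆ * ψ ⁅y, a⁆ - φ ⁅u, a⁆ * ψ ⁅y, b⁆ := by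
    have h := congrArg ψ (lie_jacobi a b u)
    simp only [map_add, map_zero] at h
    rw [hskew ψ a, hskew ψ b, hskew ψ u] at h
    simp only [hlie, hu] at h
    rw [hskew φ b u] at h
    linear_combination -h
  have huu : φ ⁅u, u⁆ = 0 := by simp
  obtain ⟨v, hv⟩ : ∃ v, φ ⁅u, v⁆ ≠ 0 := by
    by_contra! h
    exact h₀ (by rw [hjac, h, h]; ring)
  have hker (x : L) : lieForm φ x = 0 ↔ ψ ⁅y, x⁆ = 0 ∧ φ ⁅u, x⁆ = 0 := by
    constructor
    · intro h
      have h1 (w : L) : φ ⁅x, w⁆ = 0 := LinearMap.congr_fun h w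
      have h2 : φ ⁅u, x⁆ = 0 := by rw [hskew, h1, neg_zero]
      refine ⟨?_, h2⟩
      have := hjac x v
      rw [h1, h2] at this
      simpa [hv] using this.symm
    · rintro ⟨h1, h2⟩
      ext w
      rw [lieForm_apply, hjac, h1, h2]
      simp
  refine ⟨lieForm φ, lieForm ψ, fun x w => ?_, ?_, fun c => ⟨fun x => by simp, ?_, ?_⟩⟩
  · constructor
    · intro h
      simp [h]
    · rintro ⟨h1, h2⟩
      rw [lieForm_apply] at h1 h2
      rw [hdec, h1, h2]
      simp
  · rw [← finrank_ker_prod_add_two (lieForm ψ y) (lieForm φ u) (u := u) (v := v) hu huu hv]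
    refine congrArg (fun S : Submodule K L => finrank K S + 2) (Submodule.ext fun x => ?_)
    simp [hker]
  · have hz : z ∈ LinearMap.ker (lieForm ψ + c • lieForm φ) := by
      rw [LinearMap.mem_ker]
      ext w
      simp [hzl]
    have : Nontrivial (LinearMap.ker (lieForm ψ + c • lieForm φ)) :=
      ⟨⟨⟨z, hz⟩, 0, fun h => hz0 (congrArg Subtype.val h)⟩⟩
    exact Module.finrank_pos
  · set R := LinearMap.ker (lieForm ψ + c • lieForm φ) with hR
    have hmem (x : L) (hx : x ∈ R) (w : L) : ψ ⁅x, w⁆ + c * φ ⁅x, w⁆ = 0 :=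
      LinearMap.congr_fun hx w
    -- Pairing with `y`, which is in the radical of `f`, gives one of the two equations of that
    -- radical. The other, `μ = 0`, then makes `x` central, so `ker μ` has dimension at most 1.
    have hy (x : L) (hx : x ∈ R) : ψ ⁅y, x⁆ = 0 := by
      have := hmem x hx y
      rw [hskew ψ, hskew φ, hyw] at this
      simpa using this
    let μ : R →ₗ[K] K := (lieForm φ u).domRestrict R
    have hle : (LinearMap.ker μ).map R.subtype ≤ Submodule.span K {z} := by
      rintro _ ⟨⟨x, hx⟩, hxu, rfl⟩
      have h1 (w : L) : φ ⁅x, w⁆ = 0 := LinearMap.congr_fun ((hker x).2 ⟨hy x hx, hxu⟩) w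
      obtain ⟨c, hc⟩ := (hcen x).1 fun w => by
        have := hmem x hx w
        rw [h1, mul_zero, add_zero] at this
        rw [hdec, h1, this]
        simp
      exact Submodule.mem_span_singleton.2 ⟨c, hc.symm⟩
    have h1 := Submodule.finrank_mono hle
    rw [finrank_span_singleton hz0, Submodule.finrank_map_subtype_eq] at h1
    have h2 := μ.finrank_range_add_finrank_ker
    have h3 := (LinearMap.range μ).finrank_le
    rw [finrank_self] at h3
    omega

/-- Here `e` is the common dimension of the radicals of the forms `g + c • f`, fixed by parity and
the bounds 1 and 2. -/
theorem lieCommDegree_eq [Finite K] (hclass : LieModule.nilpotencyLength L L = 3)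
    (hderived : finrank K (LieAlgebra.derivedSeries K L 1) = 2)
    (hcenter : finrank K (LieAlgebra.center K L) = 1) (e : ℕ) (he₁ : 1 ≤ e) (he₂ : e ≤ 2)
    (hpar : Even (finrank K L + e)) :
    lieCommDegree L = ((Nat.card K : ℚ) - 1) * (Nat.card K : ℚ) ^ (e - 1) /
        (Nat.card K : ℚ) ^ finrank K L +
      ((Nat.card K : ℚ) ^ 2 + Nat.card K - 1) / (Nat.card K : ℚ) ^ 4 := by
  obtain ⟨f, g, hfg, hf, hg⟩ := exists_forms hclass hderived hcenter
  have hr (c : K) : (Nat.card (LinearMap.ker (g + c • f)) : ℚ) = (Nat.card K : ℚ) ^ e := by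
    obtain ⟨halt, h1, h2⟩ := hg c
    obtain ⟨k, hk⟩ := halt.exists_finrank_eq_finrank_ker_add_two_mul
    obtain ⟨j, hj⟩ := hpar
    rw [Module.natCard_eq_pow_finrank (K := K)]
    have : finrank K (LinearMap.ker (g + c • f)) = e := by omega
    rw [this]
    push_cast
    rfl
  have h := natCard_common_zeros f g _ hr
  have hq : (Nat.card K : ℚ) ≠ 0 := by exact_mod_cast Nat.card_pos.ne'
  simp only [lieCommDegree, hfg]
  obtain ⟨e, rfl⟩ : ∃ d, e = d + 1 := ⟨e - 1, by omega⟩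
  rw [Module.natCard_eq_pow_finrank (K := K) (V := L),
    Module.natCard_eq_pow_finrank (K := K) (V := LinearMap.ker f), ← hf] at h
  rw [Module.natCard_eq_pow_finrank (K := K) (V := L), ← hf, Nat.add_sub_cancel]
  generalize Nat.card {p : L × L // f p.1 p.2 = 0 ∧ g p.1 p.2 = 0} = A at h ⊢
  generalize finrank K (LinearMap.ker f) = m at h ⊢
  generalize Nat.card K = q at h hq ⊢
  push_cast at h ⊢
  have hqm : (q : ℚ) ^ m ≠ 0 := pow_ne_zero _ hq
  simp only [pow_add, pow_one] at h ⊢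
  generalize (q : ℚ) ^ m = Q at h hqm ⊢
  generalize (q : ℚ) ^ e = E at h ⊢
  have hA : (A : ℚ) = ((Q * (q : ℚ) ^ 2) ^ 2 +
      ((q : ℚ) - 1) * (Q * (q : ℚ) ^ 2) * (Q + q * (E * q))) / (q : ℚ) ^ 2 := by
    rw [eq_div_iff (pow_ne_zero 2 hq), ← h, mul_comm]
  rw [hA]
  field_simp
  ring

end Lie

theorem mainTheorem7 {K L : Type*} [Field K] [Finite K] [LieRing L] [LieAlgebra K L]
    [Module.Finite K L] (q n : ℕ) (hq : Nat.card K = q) (hn : Module.finrank K L = n)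
    (hclass : LieModule.nilpotencyLength L L = 3)
    (hderived : Module.finrank K (LieAlgebra.derivedSeries K L 1) = 2)
    (hcenter : Module.finrank K (LieAlgebra.center K L) = 1) :
    (Even n → lieCommDegree L =
      ((q : ℚ) ^ 2 - q) / (q : ℚ) ^ n + ((q : ℚ) ^ 2 + q - 1) / (q : ℚ) ^ 4) ∧
    (Odd n → lieCommDegree L =
      ((q : ℚ) - 1) / (q : ℚ) ^ n + ((q : ℚ) ^ 2 + q - 1) / (q : ℚ) ^ 4) := by
  subst hq hn
  constructor
  · intro h
    rw [lieCommDegree_eq hclass hderived hcenter 2 (by norm_num) le_rfl (h.add even_two)]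
    ring
  · intro h
    rw [lieCommDegree_eq hclass hderived hcenter 1 le_rfl (by norm_num) (h.add_odd odd_one)]
    ring
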